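/- Write $\mathbb D=\{z\in\mathbb C:|z|<1\}$. For analytic functions $F,G$ on $\mathbb D$, $F\prec G$ (subordination) means that there is an analytic $w:\mathbb D\to\mathbb D$ with $w(0)=0$ and $F=G\circ w$ on $\mathbb D$; a quotient on the left of $\prec$ is understood to be analytic on $\mathbb D$ after its removable singularities are removed. Let $\mathcal A$ be the class of analytic functions $f$ on $\mathbb D$ with $f(0)=0$, $f'(0)=1$. Let $\psi$ be a Ma--Minda function, i.e. $\psi$ is analytic and univalent on $\mathbb D$, $\operatorname{Re}\psi>0$ on $\mathbb D$, $\psi(0)=1$, $\psi'(0)>0$, and $\psi(\mathbb D)$ is symmetric about the real axis; let $\mathcal S^*(\psi)=\{f\in\mathcal A: zf'(z)/f(z)\prec\psi(z)\}$. **Theorem.** Let $h$ be analytic on $\mathbb D$ with $h(0)=0$ and $h'(0)\neq0$. Suppose that $$\operatorname{Re}\left(1+\frac{zh''(z)}{h'(z)}\right)>-\frac12\quad(z\in\mathbb D)\qquad\text{and}\qquad \frac1z\int_0^z h(t)\,dt\prec\frac{\psi(z)-1}{\psi(z)}.$$ If $f\in\mathcal A$ and $$\frac{f(z)f''(z)}{(f'(z))^2}\prec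 h(z),$$ then $f\in\mathcal S^*(\psi)$. -/

import Mathlib

open Set Metric

/-- `f` is analytic in the open unit disk and normalised by `f 0 = 0`, `f' 0 = 1`, i.e.
`f(z) = z + a₂ z² + a₃ z³ + ⋯` there (the class `𝒜`). -/
def IsNormalizedAnalytic (f : ℂ → ℂ) : Prop :=
  AnalyticOnNhd ℂ f (ball 0 1) ∧ f 0 = 0 ∧ deriv f 0 = 1

/-- A Schwarz function: an analytic self-map of the open unit disk that fixes the origin. -/
def IsSchwarzFunction (w : ℂ → ℂ) : Prop :=
  AnalyticOnNhd ℂ w (ball 0 1) ∧ MapsTo w (ball 0 1) (ball 0 1) ∧ w 0 = 0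

/-- Subordination `F ≺ G` of analytic functions in the open unit disk. -/
def Subordinate (F G : ℂ → ℂ) : Prop :=
  ∃ w : ℂ → ℂ, IsSchwarzFunction w ∧ ∀ z ∈ ball (0 : ℂ) 1, F z = G (w z)

/-- Subordination `N / M ≺ G` of a quotient of analytic functions (`M` not identically zero) that
is analytic in the open unit disk once its removable singularities have been removed:
`F` is the analytic function that the quotient represents. -/
def QuotientSubordinate (N M G : ℂ → ℂ) : Prop :=
  ∃ F : ℂ → ℂ, AnalyticOnNhd ℂ F (ball 0 1) ∧
    (∀ z ∈ ball (0 : ℂ) 1, M z ≠ 0 → F z = N z / M z) ∧ Subordinate F G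

/-- A Ma–Minda function: analytic and univalent in the open unit disk, with positive real part,
`ψ 0 = 1`, `ψ' 0 > 0`, and image of the disk symmetric about the real axis. -/
structure IsMaMinda (ψ : ℂ → ℂ) : Prop where
  analytic : AnalyticOnNhd ℂ ψ (ball 0 1)
  univalent : InjOn ψ (ball 0 1)
  re_pos : ∀ z ∈ ball (0 : ℂ) 1, 0 < (ψ z).re
  map_zero : ψ 0 = 1
  deriv_zero_pos : 0 < (deriv ψ 0).re ∧ (deriv ψ 0).im = 0
  symmetric : ∀ u ∈ ψ '' ball 0 1, (starRingEnd ℂ) u ∈ ψ '' ball 0 1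

/-- The class `𝒮*(ψ)`: all `f ∈ 𝒜` with `z f'(z) / f(z) ≺ ψ(z)`. -/
def starlikeClass (ψ : ℂ → ℂ) : Set (ℂ → ℂ) :=
  {f | IsNormalizedAnalytic f ∧ QuotientSubordinate (fun z => z * deriv f z) f ψ}

/-- The complex integral `∫₀ᶻ h(t) dt`, along the segment `t = s z`, `0 ≤ s ≤ 1`. -/
noncomputable def integralFromZero (h : ℂ → ℂ) (z : ℂ) : ℂ :=
  ∫ s in (0 : ℝ)..1, h ((s : ℂ) * z) * z

open Filter Topology

/-! Let `F` be the analytic function represented by `f f'' / f'²`, and let `p`, `q` be the averages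
of `F`, `h` over `[0, z]`. Since `(f / f')' = 1 - F`, integration gives `f = z f' (1 - p)`, so `z f'
/ f = 1 / (1 - p)`. If `p ≺ q`, then `q ≺ (ψ - 1) / ψ` gives `1 / (1 - p) ≺ ψ`. Everything thus
reduces to `p ≺ q`, where `p + z p' = F ≺ h = q + z q'`.

The bound `-1/2` on `h` enters through `convexity_of_average`: Jack's lemma applied to `2 q' / h' -
1` shows `Re (h' / q') > 1`. As `h' / q' = 2 + z q'' / q'`, this says that `q` is convex, and also
that `h ∘ q⁻¹` has derivative of positive real part on a convex domain.

For `subordinate_of_convex`, put `ω = q⁻¹ ∘ p`. Where `|ω|` is maximal on a closed disk, Jack's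
lemma turns `p + z p'` into `h(ω) + (m - 1) ω q'(ω)` with `m ≥ 1`: a point on the outer normal ray
based at `h(ω)`. By `norm_le_of_eq_add_ray`, `h` takes no such value at a point of modulus less than
`|ω|`. Since the value is `h(w(z))`, it follows that `|ω| ≤ |w(z)| ≤ |z|`, which keeps `p` inside
the image of `q`. -/

/-! ### Jack's lemma. -/

/-- **Jack's lemma**. -/
theorem jack_lemma {v : ℂ → ℂ} {R : ℝ} {z₀ : ℂ} (hv : DifferentiableOn ℂ v (ball 0 R))
    (h0 : v 0 = 0) (hz₀ : ‖z₀‖ < R) (hne : v z₀ ≠ 0)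
    (hmax : ∀ z, ‖z‖ ≤ ‖z₀‖ → ‖v z‖ ≤ ‖v z₀‖) :
    ∃ m : ℝ, 1 ≤ m ∧ z₀ * deriv v z₀ = m * v z₀ := by
  have hz0 : z₀ ≠ 0 := by rintro rfl; exact hne h0
  have hd : HasDerivAt v (deriv v z₀) z₀ :=
    (hv.differentiableAt (isOpen_ball.mem_nhds (by simpa using hz₀))).hasDerivAt
  have hvn : 0 < ‖v z₀‖ := norm_pos_iff.2 hne
  have hzn : 0 < ‖z₀‖ := norm_pos_iff.2 hz0
  have hschwarz : ∀ s : ℝ, 0 < s → s < 1 → ‖v (s * z₀)‖ ≤ s * ‖v z₀‖ := by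
    intro s hs0 hs1
    have hmem : (s : ℂ) * z₀ ∈ ball (0 : ℂ) ‖z₀‖ := by
      simp only [mem_ball_zero_iff, norm_mul, Complex.norm_real, Real.norm_eq_abs, abs_of_pos hs0]
      nlinarith
    have := Complex.dist_le_div_mul_dist_of_mapsTo_ball (f := v) (c := 0) (R₁ := ‖z₀‖)
      (R₂ := ‖v z₀‖) (hv.mono (ball_subset_ball hz₀.le))
      (fun z hz => by
        simp only [h0, mem_closedBall_zero_iff]
        exact hmax z (by simpa using (mem_ball_zero_iff.1 hz).le)) hmem
    rw [h0, dist_zero_right, dist_zero_right, norm_mul, Complex.norm_real, Real.norm_eq_abs,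
      abs_of_pos hs0] at this
    calc _ ≤ _ := this
      _ = s * ‖v z₀‖ := by field_simp
  set c : ℂ := z₀ * deriv v z₀ / v z₀ with hc
  have hcre : 1 ≤ c.re := by
    have hlin : HasDerivAt (fun s : ℝ => (s : ℂ) * z₀) z₀ (1 : ℝ) := by
      simpa using (Complex.ofRealCLM.hasDerivAt (x := (1 : ℝ))).mul_const z₀
    have h1 : HasDerivAt (fun s : ℝ => v ((s : ℂ) * z₀) / v z₀) c (1 : ℝ) := by
      have hd' : HasDerivAt v (deriv v z₀) (((1 : ℝ) : ℂ) * z₀) := by simpa using hd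
      have := (hd'.comp (1 : ℝ) hlin).div_const (v z₀)
      simpa [hc, mul_comm, Function.comp_def] using this
    have h2 : HasDerivAt (fun s : ℝ => (v ((s : ℂ) * z₀) / v z₀).re) c.re (1 : ℝ) :=
      (Complex.reCLM.hasFDerivAt.comp_hasDerivAt (1 : ℝ) h1)
    -- Along the radius, Schwarz's lemma gives `Re (v (s z₀) / v z₀) ≤ s`, with equality at `s = 1`,
    -- so the left slopes at `1` are at least `1`.
    have h3 : Tendsto (slope (fun s : ℝ => (v ((s : ℂ) * z₀) / v z₀).re) 1) (𝓝[<] 1) (𝓝 c.re) :=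
      h2.tendsto_slope.mono_left (nhdsWithin_mono _ fun x hx => ne_of_lt hx)
    refine ge_of_tendsto h3 ?_
    filter_upwards [Ioo_mem_nhdsLT (show (0 : ℝ) < 1 by norm_num)] with s hs
    rw [slope_def_field]
    have hle : (v ((s : ℂ) * z₀) / v z₀).re ≤ s := by
      refine (Complex.re_le_norm _).trans ?_
      rw [norm_div, div_le_iff₀ hvn]
      exact hschwarz s hs.1 hs.2
    have : (v (((1 : ℝ) : ℂ) * z₀) / v z₀).re = 1 := by simp [hne]
    rw [this, le_div_iff_of_neg (by linarith [hs.2])]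
    linarith
  have hcim : c.im = 0 := by
    have hlin : HasDerivAt (fun t : ℝ => Complex.exp (t * Complex.I) * z₀) (Complex.I * z₀)
        (0 : ℝ) := by
      have h := ((Complex.ofRealCLM.hasDerivAt (x := (0 : ℝ))).mul_const Complex.I).cexp.mul_const z₀
      simpa using h
    have h1 : HasDerivAt (fun t : ℝ => v (Complex.exp (t * Complex.I) * z₀) / v z₀)
        (Complex.I * c) (0 : ℝ) := by
      have hd' : HasDerivAt v (deriv v z₀) (Complex.exp (((0 : ℝ) : ℂ) * Complex.I) * z₀) := by
        simpa using hd
      have := (hd'.comp (0 : ℝ) hlin).div_const (v z₀)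
      have e : Complex.I * c = deriv v z₀ * (Complex.I * z₀) / v z₀ := by rw [hc]; ring
      rw [e]
      exact this
    have h2 : HasDerivAt (fun t : ℝ => (v (Complex.exp (t * Complex.I) * z₀) / v z₀).re)
        (Complex.I * c).re (0 : ℝ) :=
      (Complex.reCLM.hasFDerivAt.comp_hasDerivAt (0 : ℝ) h1)
    -- Along the circle the same real part is maximal at `z₀`, so its tangential derivative `-Im c`
    -- vanishes.
    have hloc : IsLocalMax (fun t : ℝ => (v (Complex.exp (t * Complex.I) * z₀) / v z₀).re) 0 := by
      refine Eventually.of_forall fun t => ?_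
      have e : (v (Complex.exp (((0 : ℝ) : ℂ) * Complex.I) * z₀) / v z₀).re = 1 := by simp [hne]
      refine le_of_le_of_eq ?_ e.symm
      refine (Complex.re_le_norm _).trans ?_
      rw [norm_div, div_le_one hvn]
      exact hmax _ (by simp [Complex.norm_exp_ofReal_mul_I])
    have := hloc.hasDerivAt_eq_zero h2
    simpa using this
  refine ⟨c.re, hcre, ?_⟩
  have : c = (c.re : ℂ) := by apply Complex.ext <;> simp [hcim]
  rw [← this, hc, div_mul_cancel₀ _ hne]

/-- An analytic function on the unit disk vanishing at the origin is bounded by `1` if no point with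
`‖v z‖ = 1` satisfies the conclusion of Jack's lemma. -/
theorem norm_lt_one_of_jack {v : ℂ → ℂ} (hv : DifferentiableOn ℂ v (ball 0 1)) (h0 : v 0 = 0)
    (H : ∀ z ∈ ball (0 : ℂ) 1, ‖v z‖ = 1 → ∀ m : ℝ, 1 ≤ m → z * deriv v z = m * v z → False) :
    ∀ z ∈ ball (0 : ℂ) 1, ‖v z‖ < 1 := by
  intro z₁ hz₁
  by_contra! hcon
  have hsub : closedBall (0 : ℂ) ‖z₁‖ ⊆ ball 0 1 := closedBall_subset_ball (by simpa using hz₁)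
  have hcont : ContinuousOn (fun z => ‖v z‖) (closedBall (0 : ℂ) ‖z₁‖) :=
    (hv.continuousOn.mono hsub).norm
  set K : Set ℂ := closedBall (0 : ℂ) ‖z₁‖ ∩ (fun z => ‖v z‖) ⁻¹' Ici 1 with hK
  have hKc : IsCompact K :=
    (isCompact_closedBall _ _).of_isClosed_subset
      (hcont.preimage_isClosed_of_isClosed isClosed_closedBall isClosed_Ici) inter_subset_left
  -- A point of least modulus with `‖v‖ ≥ 1`: on its closed disk `‖v‖ ≤ 1`, as Jack's lemma
  -- requires.
  obtain ⟨z₀, hz₀, hmin⟩ := hKc.exists_isMinOn ⟨z₁, by simpa [hK] using hcon⟩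
    (continuous_norm.continuousOn (s := K))
  have hz₀n : ‖z₀‖ ≤ ‖z₁‖ := by simpa using hz₀.1
  have hz₀v : 1 ≤ ‖v z₀‖ := hz₀.2
  have hz₀b : z₀ ∈ ball (0 : ℂ) 1 := hsub hz₀.1
  have hlt : ∀ z ∈ ball (0 : ℂ) ‖z₀‖, ‖v z‖ ≤ 1 := by
    intro z hz
    by_contra! hz'
    have hzn : ‖z‖ < ‖z₀‖ := by simpa using hz
    have : ‖z₀‖ ≤ ‖z‖ := hmin (show z ∈ K from ⟨by simpa using hzn.le.trans hz₀n, hz'.le⟩)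
    linarith
  have hz0 : ‖z₀‖ ≠ 0 := by
    intro h
    rw [norm_eq_zero.1 h, h0] at hz₀v
    norm_num at hz₀v
  have hle : ∀ z, ‖z‖ ≤ ‖z₀‖ → ‖v z‖ ≤ 1 := by
    intro z hz
    refine le_on_closure (f := fun z => ‖v z‖) (g := fun _ => 1) hlt ?_ continuousOn_const
      (show z ∈ closure (ball (0 : ℂ) ‖z₀‖) by rw [closure_ball _ hz0]; simpa using hz)
    rw [closure_ball _ hz0]
    exact hcont.mono (closedBall_subset_closedBall hz₀n)
  have h1 : ‖v z₀‖ = 1 := le_antisymm (hle _ le_rfl) hz₀v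
  obtain ⟨m, hm, hmeq⟩ := jack_lemma hv h0 (by simpa using hz₀b)
    (norm_ne_zero_iff.1 (by rw [h1]; norm_num)) (fun z hz => (hle z hz).trans h1.ge)
  exact H z₀ hz₀b h1 m hm hmeq

/-! ### Averages and their convexity. -/

/-- A lower bound on `Re (z k' / k)` forces `k` to be zero free (even with `x / 0 = 0`). -/
theorem ne_zero_of_re_logDeriv_bounded_below {k : ℂ → ℂ} {C : ℝ}
    (hk : AnalyticOnNhd ℂ k (ball 0 1))
    (hk0 : k 0 ≠ 0) (hre : ∀ z ∈ ball (0 : ℂ) 1, C ≤ (z * deriv k z / k z).re) :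
    ∀ z ∈ ball (0 : ℂ) 1, k z ≠ 0 := by
  intro z₀ hz₀ hkz
  have hz0 : z₀ ≠ 0 := by rintro rfl; exact hk0 hkz
  have hnot : ¬ ∀ᶠ z in 𝓝 z₀, k z = 0 := fun h => hk0
    (hk.eqOn_zero_of_preconnected_of_eventuallyEq_zero (convex_ball _ _).isPreconnected hz₀ h
      (mem_ball_self one_pos))
  obtain ⟨n, g, hg, hg0, heq⟩ :=
    ((hk z₀ hz₀).exists_eventuallyEq_pow_smul_nonzero_iff).2 hnot
  obtain ⟨m, rfl⟩ : ∃ m, n = m + 1 := by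
    refine Nat.exists_eq_succ_of_ne_zero ?_
    rintro rfl
    have := heq.self_of_nhds
    simp [hkz] at this
    exact hg0 this.symm
  -- At a zero of order `m + 1`, `(z - z₀) k' / k` tends to `m + 1 ≥ 1`.
  have hT : Tendsto (fun z => ((m : ℂ) + 1) + (z - z₀) * deriv g z / g z) (𝓝[≠] z₀)
      (𝓝 ((m : ℂ) + 1)) := by
    have : ContinuousAt (fun z => ((m : ℂ) + 1) + (z - z₀) * deriv g z / g z) z₀ :=
      continuousAt_const.add (((continuousAt_id.sub continuousAt_const).mul
        hg.deriv.continuousAt).div hg.continuousAt hg0)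
    have h2 := this.tendsto
    simp only [sub_self, zero_mul, zero_div, add_zero] at h2
    exact h2.mono_left nhdsWithin_le_nhds
  have hTeq : ∀ᶠ z in 𝓝[≠] z₀,
      (z - z₀) * (deriv k z / k z) = ((m : ℂ) + 1) + (z - z₀) * deriv g z / g z := by
    rw [eventually_nhdsWithin_iff]
    filter_upwards [heq.eventually_nhds, hg.eventually_analyticAt,
      hg.continuousAt.eventually_ne hg0] with z h1 h2 h3 h4
    have h4' : z - z₀ ≠ 0 := sub_ne_zero.2 h4
    have hder : HasDerivAt (fun z => (z - z₀) ^ (m + 1) • g z)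
        (((m + 1 : ℕ) : ℂ) * (z - z₀) ^ m * 1 * g z + (z - z₀) ^ (m + 1) * deriv g z) z := by
      exact (((hasDerivAt_id z).sub_const z₀).fun_pow (m + 1)).fun_mul
        h2.differentiableAt.hasDerivAt
    rw [(show k =ᶠ[𝓝 z] _ from h1).deriv_eq, hder.deriv, h1.self_of_nhds]
    simp only [smul_eq_mul]
    push_cast
    field_simp
    ring
  have hTk := hT.congr' (hTeq.mono fun z h => h.symm)
  -- On the radial approach `z = z₀ (1 - e)` one has `(1 - e) (z - z₀) = -e z`, so the lower bound
  -- `C` forces the limit of the real part to be at most `0`.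
  have hpath : Tendsto (fun e : ℝ => z₀ * (1 - (e : ℂ))) (𝓝[>] 0) (𝓝[≠] z₀) := by
    refine tendsto_nhdsWithin_iff.2 ⟨?_, ?_⟩
    · have : ContinuousAt (fun e : ℝ => z₀ * (1 - (e : ℂ))) 0 := by fun_prop
      have h2 := this.tendsto
      simp only [Complex.ofReal_zero, sub_zero, mul_one] at h2
      exact h2.mono_left nhdsWithin_le_nhds
    · filter_upwards [self_mem_nhdsWithin] with e he
      have he' : (e : ℂ) ≠ 0 := by exact_mod_cast (ne_of_gt he)
      intro h
      have h' : z₀ * (1 - (e : ℂ)) = z₀ := h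
      have : z₀ * (e : ℂ) = 0 := by linear_combination -h'
      simp [hz0, he'] at this
  have hlim := (Complex.continuous_re.tendsto _).comp (hTk.comp hpath)
  have hlim2 : Tendsto (fun e : ℝ => (1 - e) * (Complex.re ∘
      (fun z => (z - z₀) * (deriv k z / k z)) ∘ fun e : ℝ => z₀ * (1 - (e : ℂ))) e)
      (𝓝[>] 0) (𝓝 ((1 - 0) * ((m : ℂ) + 1).re)) := by
    refine Tendsto.mul ?_ hlim
    exact ((continuous_const.sub continuous_id).tendsto (0 : ℝ)).mono_left nhdsWithin_le_nhds
  have hlim3 : Tendsto (fun e : ℝ => -(C * e)) (𝓝[>] 0) (𝓝 (-(C * 0))) :=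
    ((by fun_prop : Continuous fun e : ℝ => -(C * e)).tendsto 0).mono_left nhdsWithin_le_nhds
  have := le_of_tendsto_of_tendsto hlim2 hlim3 ?_
  · simp at this
    have h : (0 : ℝ) ≤ m := Nat.cast_nonneg m
    linarith
  · filter_upwards [Ioo_mem_nhdsGT (show (0 : ℝ) < 1 by norm_num)] with e he
    have hzb : z₀ * (1 - (e : ℂ)) ∈ ball (0 : ℂ) 1 := by
      have h1 : ‖(1 - (e : ℂ))‖ ≤ 1 := by
        rw [← Complex.ofReal_one, ← Complex.ofReal_sub, Complex.norm_real, Real.norm_eq_abs,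
          abs_of_pos (by linarith [he.2])]
        linarith [he.1]
      rw [mem_ball_zero_iff, norm_mul] at *
      nlinarith [norm_nonneg z₀]
    have h1 := hre _ hzb
    simp only [Function.comp_apply]
    set D := deriv k (z₀ * (1 - (e : ℂ))) / k (z₀ * (1 - (e : ℂ)))
    rw [mul_div_assoc] at h1
    have e1 : z₀ * (1 - (e : ℂ)) - z₀ = ((-e : ℝ) : ℂ) * z₀ := by push_cast; ring
    have e2 : z₀ * (1 - (e : ℂ)) * D = ((1 - e : ℝ) : ℂ) * (z₀ * D) := by push_cast; ring
    rw [e2, Complex.re_ofReal_mul] at h1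
    rw [e1, mul_assoc, Complex.re_ofReal_mul]
    nlinarith [he.1, he.2]

/-- The average `z⁻¹ ∫₀ᶻ h` as an analytic function. -/
theorem exists_average {h : ℂ → ℂ} (hh : AnalyticOnNhd ℂ h (ball 0 1)) :
    ∃ Φ q : ℂ → ℂ, Φ 0 = 0 ∧ (∀ z ∈ ball (0 : ℂ) 1, HasDerivAt Φ (h z) z) ∧
      AnalyticOnNhd ℂ q (ball 0 1) ∧ (∀ z, Φ z = z * q z) ∧
      ∀ z ∈ ball (0 : ℂ) 1, h z = q z + z * deriv q z := by
  obtain ⟨Φ, hΦ0, hΦ⟩ := (hh.differentiableOn.isExactOn_ball).with_val_at 0 0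
  have hΦd : DifferentiableOn ℂ Φ (ball 0 1) := fun z hz =>
    (hΦ z hz).differentiableAt.differentiableWithinAt
  have hq : DifferentiableOn ℂ (dslope Φ 0) (ball 0 1) :=
    (Complex.differentiableOn_dslope (ball_mem_nhds _ one_pos)).2 hΦd
  have hmul : ∀ z, Φ z = z * dslope Φ 0 z := fun z => by
    have := sub_smul_dslope Φ 0 z
    simpa [hΦ0] using this.symm
  refine ⟨Φ, dslope Φ 0, hΦ0, hΦ, hq.analyticOnNhd isOpen_ball, hmul, fun z hz => ?_⟩
  have h1 := (hasDerivAt_id z).mul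
    (hq.differentiableAt (isOpen_ball.mem_nhds hz)).hasDerivAt
  have h2 := (hΦ z hz).unique (h1.congr_of_eventuallyEq (Eventually.of_forall hmul))
  simpa using h2

theorem integralFromZero_eq {h Φ : ℂ → ℂ} (hh : AnalyticOnNhd ℂ h (ball 0 1)) (hΦ0 : Φ 0 = 0)
    (hΦ : ∀ z ∈ ball (0 : ℂ) 1, HasDerivAt Φ (h z) z) {z : ℂ} (hz : z ∈ ball (0 : ℂ) 1) :
    integralFromZero h z = Φ z := by
  have hmem : ∀ s ∈ uIcc (0 : ℝ) 1, (s : ℂ) * z ∈ ball (0 : ℂ) 1 := by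
    intro s hs
    rw [uIcc_of_le zero_le_one] at hs
    rw [mem_ball_zero_iff] at *
    rw [norm_mul, Complex.norm_real, Real.norm_eq_abs, abs_of_nonneg hs.1]
    nlinarith [hs.2, norm_nonneg z]
  have hlin : ∀ s : ℝ, HasDerivAt (fun s : ℝ => (s : ℂ) * z) z s := fun s => by
    simpa using (Complex.ofRealCLM.hasDerivAt (x := s)).mul_const z
  have := intervalIntegral.integral_eq_sub_of_hasDerivAt (a := 0) (b := 1)
    (f := fun s : ℝ => Φ ((s : ℂ) * z)) (f' := fun s : ℝ => h ((s : ℂ) * z) * z)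
    (fun s hs => (hΦ _ (hmem s hs)).comp s (hlin s)) ?_
  · rw [integralFromZero, this]; simp [hΦ0]
  · refine ContinuousOn.intervalIntegrable ?_
    exact (hh.continuousOn.comp (by fun_prop) hmem).mul continuousOn_const

/-- If `h = q + z q'` with `Re (1 + z h'' / h') > -1/2`, then `q` is convex, and the derivative of
`h` with respect to `q` has real part greater than one. -/
theorem convexity_of_average {h q : ℂ → ℂ} (hq : AnalyticOnNhd ℂ q (ball 0 1))
    (hh : AnalyticOnNhd ℂ h (ball 0 1)) (hh1 : deriv h 0 ≠ 0)
    (hre : ∀ z ∈ ball (0 : ℂ) 1,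
      -(1 / 2 : ℝ) < (1 + z * deriv (deriv h) z / deriv h z).re)
    (hqh : ∀ z ∈ ball (0 : ℂ) 1, h z = q z + z * deriv q z) :
    ∀ z ∈ ball (0 : ℂ) 1, deriv q z ≠ 0 ∧ 1 < (deriv h z / deriv q z).re ∧
      0 < (1 + z * deriv (deriv q) z / deriv q z).re := by
  -- With `x / 0 = 0` the hypothesis says nothing at a zero of `h'` itself; zeros are excluded by
  -- the values nearby.
  have hh' : ∀ z ∈ ball (0 : ℂ) 1, deriv h z ≠ 0 :=
    ne_zero_of_re_logDeriv_bounded_below (C := -(3 / 2)) hh.deriv hh1 fun z hz => by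
      have := hre z hz
      rw [Complex.add_re, Complex.one_re] at this
      linarith
  have hd : ∀ z ∈ ball (0 : ℂ) 1, deriv h z = 2 * deriv q z + z * deriv (deriv q) z := by
    intro z hz
    have h1 := ((hq z hz).differentiableAt.hasDerivAt).fun_add
      ((hasDerivAt_id z).fun_mul (hq.deriv z hz).differentiableAt.hasDerivAt)
    have h2 : h =ᶠ[𝓝 z] fun z => q z + id z * deriv q z :=
      Filter.eventuallyEq_of_mem (isOpen_ball.mem_nhds hz) hqh
    rw [(h1.congr_of_eventuallyEq h2).deriv]
    simp only [id]
    ring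
  -- `h' / q' = 2 / (1 + v)`, and `2 / (1 + v)` has real part above `1` when `|v| < 1` and `v ≠ -1`.
  set v : ℂ → ℂ := fun z => 2 * deriv q z / deriv h z - 1 with hv
  have hvd : ∀ z ∈ ball (0 : ℂ) 1, HasDerivAt v ((2 * deriv (deriv q) z * deriv h z -
      2 * deriv q z * deriv (deriv h) z) / deriv h z ^ 2) z := fun z hz =>
    ((((hq.deriv z hz).differentiableAt.hasDerivAt).const_mul 2).fun_div
      (hh.deriv z hz).differentiableAt.hasDerivAt (hh' z hz)).sub_const 1
  have hv1 : ∀ z ∈ ball (0 : ℂ) 1, ‖v z‖ < 1 := by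
    refine norm_lt_one_of_jack
      (fun z hz => (hvd z hz).differentiableAt.differentiableWithinAt) ?_ ?_
    · have := hd 0 (mem_ball_self one_pos)
      have h0 := hh1
      simp only [hv]
      rw [this] at h0 ⊢
      simp only [zero_mul, add_zero] at h0 ⊢
      rw [div_self h0, sub_self]
    · intro z hz hn m hm hj
      have hode : z * deriv v z + (1 + v z) * (2 + z * deriv (deriv h) z / deriv h z) = 2 := by
        have hz' := hh' z hz
        rw [(hvd z hz).deriv]
        simp only [hv]
        field_simp
        linear_combination -2 * deriv h z * hd z hz
      rw [hj] at hode
      have hQ := hre z hz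
      set Q := z * deriv (deriv h) z / deriv h z
      set u := v z
      have hns : u.re ^ 2 + u.im ^ 2 = 1 := by
        have := Complex.sq_norm u
        rw [hn, Complex.normSq_apply] at this
        nlinarith
      have e1 := congrArg Complex.re hode
      have e2 := congrArg Complex.im hode
      simp at e1 e2 hQ
      have hu1 : 0 < 1 + u.re := by
        have hge : -1 ≤ u.re := by nlinarith [sq_nonneg u.im]
        rcases hge.lt_or_eq with h | h
        · linarith
        · have him : u.im = 0 := by
            have : u.im ^ 2 = 0 := by rw [← h] at hns; linarith
            exact pow_eq_zero_iff two_ne_zero |>.1 this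
          rw [← h, him] at e1
          linarith
      -- Real part of the equation times the conjugate of `1 + v`, using `|1 + v|² = 2 (1 + Re v)`.
      -- It yields `Re (1 + z h'' / h') = -m / 2 ≤ -1/2`, the excluded range.
      have key : 2 * (1 + u.re) * (2 + Q.re) = (2 - m) * (1 + u.re) := by
        linear_combination (1 + u.re) * e1 + u.im * e2 - (2 + Q.re + m) * hns
      have : 2 * (2 + Q.re) = 2 - m := by
        apply mul_left_cancel₀ hu1.ne'
        linear_combination key
      linarith
  intro z hz
  have hz' := hh' z hz
  have hvz := hv1 z hz
  have hq' : deriv q z ≠ 0 := by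
    intro h0
    simp [hv, h0] at hvz
  have hR : 1 < (deriv h z / deriv q z).re := by
    have e : deriv h z / deriv q z = 2 / (1 + v z) := by
      simp only [hv]
      field_simp
      ring
    have hne : 1 + v z ≠ 0 := by
      simp only [hv]
      rw [add_sub_cancel]
      exact div_ne_zero (mul_ne_zero two_ne_zero hq') hz'
    rw [e, Complex.div_re]
    have hns : (v z).re ^ 2 + (v z).im ^ 2 < 1 := by
      have := Complex.sq_norm (v z)
      rw [Complex.normSq_apply] at this
      nlinarith [norm_nonneg (v z)]
    have hpos : 0 < Complex.normSq (1 + v z) := Complex.normSq_pos.2 hne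
    simp only [Complex.re_ofNat, Complex.im_ofNat, zero_mul, zero_div, add_zero]
    rw [lt_div_iff₀ hpos, Complex.normSq_apply]
    simp
    nlinarith
  refine ⟨hq', hR, ?_⟩
  have e : deriv h z / deriv q z = 1 + (1 + z * deriv (deriv q) z / deriv q z) := by
    rw [hd z hz]
    field_simp
    ring
  rw [e, Complex.add_re, Complex.one_re] at hR
  linarith

/-! ### Support properties of convex functions. -/

section Convex

variable {q : ℂ → ℂ}

/-- Strict support property of the image of a circle under a convex function. -/
theorem re_pos_on_circle (hq : AnalyticOnNhd ℂ q (ball 0 1))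
    (hq' : ∀ z ∈ ball (0 : ℂ) 1, deriv q z ≠ 0)
    (hconv : ∀ z ∈ ball (0 : ℂ) 1, 0 < (1 + z * deriv (deriv q) z / deriv q z).re)
    {ζ : ℂ} (hζ : ζ ∈ ball (0 : ℂ) 1) (hζ0 : ζ ≠ 0) {s : ℝ} (hs : s ∈ Ioo 0 (2 * Real.pi)) :
    0 < ((q ζ - q (Complex.exp (s * Complex.I) * ζ)) / (ζ * deriv q ζ)).re := by
  -- `g` is the branch of `log (q' / q' ζ)` vanishing at `ζ`.
  obtain ⟨g, hg0, hg⟩ := (((hq.deriv.deriv.div hq.deriv hq').differentiableOn).isExactOn_ball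
    (c := 0) (r := 1)).with_val_at ζ 0
  have hexp : ∀ z ∈ ball (0 : ℂ) 1, deriv q z = deriv q ζ * Complex.exp (g z) := by
    have hd : ∀ z ∈ ball (0 : ℂ) 1, HasDerivAt (fun z => deriv q z * Complex.exp (-g z)) 0 z := by
      intro z hz
      have h1 := (hq.deriv z hz).differentiableAt.hasDerivAt.fun_mul (hg z hz).fun_neg.cexp
      convert! h1 using 1
      have := hq' z hz
      field_simp
      ring
    intro z hz
    have := isOpen_ball.is_const_of_deriv_eq_zero (convex_ball (0 : ℂ) 1).isPreconnected
      (fun z hz => (hd z hz).differentiableAt.differentiableWithinAt)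
      (fun z hz => (hd z hz).deriv) hz hζ
    simp only [hg0, neg_zero, Complex.exp_zero, mul_one] at this
    rw [← this, mul_assoc, ← Complex.exp_add, neg_add_cancel, Complex.exp_zero, mul_one]
  set γ : ℝ → ℂ := fun t => Complex.exp (t * Complex.I) * ζ with hγ
  have hγmem : ∀ t, γ t ∈ ball (0 : ℂ) 1 := fun t => by
    simpa [hγ, Complex.norm_exp_ofReal_mul_I] using hζ
  have hγd : ∀ t, HasDerivAt γ (Complex.I * γ t) t := fun t => by
    have h := ((Complex.ofRealCLM.hasDerivAt (x := t)).mul_const Complex.I).cexp.mul_const ζ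
    convert! h using 1
    simp [hγ]
    ring
  have hγ0 : γ 0 = ζ := by simp [hγ]
  have hγ2 : γ (2 * Real.pi) = ζ := by simp [hγ, Complex.exp_two_pi_mul_I]
  -- Angle of the tangent to the image curve, relative to its start; convexity makes it increase
  -- from `0` to `2π`.
  set A : ℝ → ℝ := fun t => t + (g (γ t)).im with hA
  have hAmono : StrictMono A := by
    refine strictMono_of_hasDerivAt_pos
      (f' := fun t => (1 + γ t * deriv (deriv q) (γ t) / deriv q (γ t)).re) (fun t => ?_)
      fun t => hconv _ (hγmem t)
    have h1 := (hg _ (hγmem t)).comp t (hγd t)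
    have h2 : HasDerivAt (fun t => (g (γ t)).im) _ t :=
      (Complex.imCLM.hasFDerivAt.comp_hasDerivAt t h1)
    convert! (hasDerivAt_id t).fun_add h2 using 1
    rw [Complex.add_re, Complex.one_re]
    congr 1
    have e : deriv (deriv q) (γ t) / deriv q (γ t) * (Complex.I * γ t) =
        Complex.I * (γ t * deriv (deriv q) (γ t) / deriv q (γ t)) := by ring
    rw [e]
    simp
  have hA0 : A 0 = 0 := by simp [hA, hγ0, hg0]
  have hA2 : A (2 * Real.pi) = 2 * Real.pi := by simp only [hA, hγ2, hg0]; simp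
  set φ : ℝ → ℝ := fun t => ((q ζ - q (γ t)) / (ζ * deriv q ζ)).re with hφ
  have hφd : ∀ t, HasDerivAt φ (Real.exp (g (γ t)).re * Real.sin (A t)) t := by
    intro t
    have h1 := (((hq _ (hγmem t)).differentiableAt.hasDerivAt.comp t (hγd t)).const_sub
      (q ζ)).div_const (ζ * deriv q ζ)
    have h2 : HasDerivAt φ _ t := (Complex.reCLM.hasFDerivAt.comp_hasDerivAt t h1)
    convert! h2 using 1
    have hqζ := hq' ζ hζ
    have e : -(deriv q (γ t) * (Complex.I * γ t)) / (ζ * deriv q ζ) =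
        -(Complex.I * Complex.exp (t * Complex.I + g (γ t))) := by
      rw [hexp _ (hγmem t), Complex.exp_add]
      simp only [hγ]
      field_simp
    rw [e]
    simp [Complex.exp_im, hA]
  have hφ0 : φ 0 = 0 := by simp [hφ, hγ0]
  have hφ2 : φ (2 * Real.pi) = 0 := by simp only [hφ, hγ2]; simp
  have hcont : Continuous φ := continuous_iff_continuousAt.2 fun t => (hφd t).continuousAt
  change 0 < φ s
  -- `φ'` has the sign of `sin A`, so `φ` rises and then falls between its two zeros; `s` is
  -- compared with the endpoint on its own side of the peak.
  rcases le_or_gt (A s) Real.pi with hle | hgt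
  · have : StrictMonoOn φ (Icc 0 s) := by
      refine strictMonoOn_of_deriv_pos (convex_Icc _ _) hcont.continuousOn fun x hx => ?_
      rw [interior_Icc] at hx
      rw [(hφd x).deriv]
      refine mul_pos (Real.exp_pos _) (Real.sin_pos_of_pos_of_lt_pi ?_ ?_)
      · rw [← hA0]; exact hAmono hx.1
      · exact (hAmono hx.2).trans_le hle
    rw [← hφ0]
    exact this ⟨le_rfl, hs.1.le⟩ ⟨hs.1.le, le_rfl⟩ hs.1
  · have : StrictAntiOn φ (Icc s (2 * Real.pi)) := by
      refine strictAntiOn_of_deriv_neg (convex_Icc _ _) hcont.continuousOn fun x hx => ?_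
      rw [interior_Icc] at hx
      rw [(hφd x).deriv]
      refine mul_neg_of_pos_of_neg (Real.exp_pos _) ?_
      have h1 : Real.pi < A x := hgt.trans (hAmono hx.1)
      have h2 : A x < 2 * Real.pi := by rw [← hA2]; exact hAmono hx.2
      rw [← Real.sin_sub_two_pi]
      exact Real.sin_neg_of_neg_of_neg_pi_lt (by linarith) (by linarith)
    rw [← hφ2]
    exact this ⟨le_rfl, hs.2.le⟩ ⟨hs.2.le, le_rfl⟩ hs.2

theorem exists_exp_mul_of_norm_eq {w ζ : ℂ} (hζ0 : ζ ≠ 0) (hn : ‖w‖ = ‖ζ‖) (hne : w ≠ ζ) :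
    ∃ s ∈ Ioo 0 (2 * Real.pi), w = Complex.exp (s * Complex.I) * ζ := by
  have hu : ‖w / ζ‖ = 1 := by rw [norm_div, hn, div_self (norm_ne_zero_iff.2 hζ0)]
  have he : Complex.exp ((w / ζ).arg * Complex.I) = w / ζ := by
    have := Complex.norm_mul_exp_arg_mul_I (w / ζ)
    rwa [hu, Complex.ofReal_one, one_mul] at this
  have harg : (w / ζ).arg ≠ 0 := by
    intro h0
    rw [h0] at he
    simp only [Complex.ofReal_zero, zero_mul, Complex.exp_zero] at he
    rw [eq_div_iff hζ0, one_mul] at he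
    exact hne he.symm
  rcases lt_or_gt_of_ne harg with h | h
  · refine ⟨(w / ζ).arg + 2 * Real.pi, ⟨?_, by linarith⟩, ?_⟩
    · linarith [Complex.neg_pi_lt_arg (w / ζ), Real.pi_pos]
    · push_cast
      rw [add_mul, Complex.exp_add, Complex.exp_two_pi_mul_I, mul_one, he, div_mul_cancel₀ _ hζ0]
  · exact ⟨(w / ζ).arg, ⟨h, by linarith [Complex.arg_le_pi (w / ζ), Real.pi_pos]⟩, by
      rw [he, div_mul_cancel₀ _ hζ0]⟩

/-- Strict support property of the image of a disk under a convex function. -/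
theorem re_pos_of_norm_le (hq : AnalyticOnNhd ℂ q (ball 0 1))
    (hq' : ∀ z ∈ ball (0 : ℂ) 1, deriv q z ≠ 0)
    (hconv : ∀ z ∈ ball (0 : ℂ) 1, 0 < (1 + z * deriv (deriv q) z / deriv q z).re)
    {ζ w : ℂ} (hζ : ζ ∈ ball (0 : ℂ) 1) (hζ0 : ζ ≠ 0) (hw : ‖w‖ ≤ ‖ζ‖) (hne : w ≠ ζ) :
    0 < ((q ζ - q w) / (ζ * deriv q ζ)).re := by
  have hcirc : ∀ w, ‖w‖ = ‖ζ‖ → w ≠ ζ → 0 < ((q ζ - q w) / (ζ * deriv q ζ)).re := by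
    intro w hn hne
    obtain ⟨s, hs, rfl⟩ := exists_exp_mul_of_norm_eq hζ0 hn hne
    exact re_pos_on_circle hq hq' hconv hζ hζ0 hs
  rcases hw.eq_or_lt with h | hlt
  · exact hcirc w h hne
  have hr : ‖ζ‖ ≠ 0 := norm_ne_zero_iff.2 hζ0
  -- The maximum principle for `|exp (-·)|` carries the circle estimate inside; equality at an
  -- interior point would spread to `-ζ`, where the estimate is strict.
  set E : ℂ → ℂ := fun w => Complex.exp (-((q ζ - q w) / (ζ * deriv q ζ))) with hE
  have hEn : ∀ w, ‖E w‖ = Real.exp (-((q ζ - q w) / (ζ * deriv q ζ)).re) := fun w => by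
    simp [hE, Complex.norm_exp]
  have hsub : closedBall (0 : ℂ) ‖ζ‖ ⊆ ball 0 1 := closedBall_subset_ball (by simpa using hζ)
  have hEd : DifferentiableOn ℂ E (ball 0 1) :=
    (((hq.differentiableOn.const_sub (q ζ)).div_const _).neg).cexp
  have hEc : DiffContOnCl ℂ E (ball 0 ‖ζ‖) := by
    refine DifferentiableOn.diffContOnCl (hEd.mono ?_)
    rwa [closure_ball _ hr]
  have hle : ∀ w, ‖w‖ ≤ ‖ζ‖ → ‖E w‖ ≤ 1 := by
    intro w hw
    refine Complex.norm_le_of_forall_mem_frontier_norm_le isBounded_ball hEc (fun x hx => ?_)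
      (show w ∈ closure (ball (0 : ℂ) ‖ζ‖) by rw [closure_ball _ hr]; simpa using hw)
    rw [frontier_ball _ hr, mem_sphere_zero_iff_norm] at hx
    rw [hEn, Real.exp_le_one_iff, neg_nonpos]
    by_cases hxζ : x = ζ
    · simp [hxζ]
    · exact (hcirc x hx hxζ).le
  have hlt1 : ‖E w‖ < 1 := by
    refine (hle w hlt.le).lt_of_ne fun h1 => ?_
    have := Complex.norm_eqOn_closure_of_isPreconnected_of_isMaxOn
      (convex_ball (0 : ℂ) ‖ζ‖).isPreconnected isOpen_ball hEc (c := w) (by simpa using hlt)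
      (fun x hx => by
        simp only [mem_ofPred_eq, Function.comp_apply, h1]
        exact hle x (by simpa using (mem_ball_zero_iff.1 hx).le))
      (show -ζ ∈ closure (ball (0 : ℂ) ‖ζ‖) by rw [closure_ball _ hr]; simp)
    simp only [Function.comp_apply, Function.const_apply, h1] at this
    rw [hEn, Real.exp_eq_one_iff, neg_eq_zero] at this
    exact (hcirc (-ζ) (norm_neg _) (fun h => hζ0 (self_eq_neg.1 h.symm))).ne' this
  rw [hEn, Real.exp_lt_one_iff] at hlt1
  linarith

/-- If two distinct points shared a value, the support quantity based at the one of larger modulus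
would be zero rather than positive. -/
theorem injOn_of_convex (hq : AnalyticOnNhd ℂ q (ball 0 1))
    (hq' : ∀ z ∈ ball (0 : ℂ) 1, deriv q z ≠ 0)
    (hconv : ∀ z ∈ ball (0 : ℂ) 1, 0 < (1 + z * deriv (deriv q) z / deriv q z).re) :
    InjOn q (ball 0 1) := by
  have key : ∀ a ∈ ball (0 : ℂ) 1, ∀ b ∈ ball (0 : ℂ) 1, ‖a‖ ≤ ‖b‖ → q a = q b → a = b := by
    intro a ha b hb hab he
    by_contra hne
    have hb0 : b ≠ 0 := by
      rintro rfl
      exact hne (by simpa using hab)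
    have := re_pos_of_norm_le hq hq' hconv hb hb0 hab hne
    simp [he] at this
  intro a ha b hb he
  rcases le_total ‖a‖ ‖b‖ with h | h
  · exact key a ha b hb h he
  · exact (key b hb a ha h he.symm).symm

end Convex

/-! ### Convex image, difference quotients and normal rays. -/

section Convex

variable {q : ℂ → ℂ}

theorem isOpen_image_of_convex (hq : AnalyticOnNhd ℂ q (ball 0 1))
    (hq' : ∀ z ∈ ball (0 : ℂ) 1, deriv q z ≠ 0) {s : Set ℂ} (hs : s ⊆ ball 0 1)
    (hso : IsOpen s) : IsOpen (q '' s) := by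
  rcases hq.is_constant_or_isOpen (convex_ball (0 : ℂ) 1).isPreconnected with ⟨w, hw⟩ | h
  · have h0 := mem_ball_self (x := (0 : ℂ)) one_pos
    have : q =ᶠ[𝓝 0] fun _ => w := Filter.eventuallyEq_of_mem (isOpen_ball.mem_nhds h0) hw
    exact absurd (by rw [this.deriv_eq, deriv_const]) (hq' 0 h0)
  · exact h s hs hso

/-- The image of the unit disk under a convex function is convex. -/
theorem convex_image_of_convex (hq : AnalyticOnNhd ℂ q (ball 0 1))
    (hq' : ∀ z ∈ ball (0 : ℂ) 1, deriv q z ≠ 0)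
    (hconv : ∀ z ∈ ball (0 : ℂ) 1, 0 < (1 + z * deriv (deriv q) z / deriv q z).re) :
    Convex ℝ (q '' ball 0 1) := by
  rw [convex_iff_segment_subset]
  rintro _ ⟨a, ha, rfl⟩ _ ⟨b, hb, rfl⟩
  obtain ⟨ρ, hρ, hρ1⟩ := exists_between
    (max_lt (mem_ball_zero_iff.1 ha) (mem_ball_zero_iff.1 hb))
  have haρ : ‖a‖ < ρ := (le_max_left _ _).trans_lt hρ
  have hbρ : ‖b‖ < ρ := (le_max_right _ _).trans_lt hρ
  have hρ0 : ρ ≠ 0 := ((norm_nonneg a).trans_lt haρ).ne'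
  have hsub : closedBall (0 : ℂ) ρ ⊆ ball 0 1 := closedBall_subset_ball hρ1
  have hclosed : IsClosed (q '' closedBall 0 ρ) :=
    ((isCompact_closedBall _ _).image_of_continuousOn (hq.continuousOn.mono hsub)).isClosed
  -- Connectedness of the segment: leaving the image of the `ρ`-disk, it would meet some `q ζ` with
  -- `‖ζ‖ = ρ`. Both ends lie strictly on one side of the support line there, so no convex
  -- combination of them equals `q ζ`.
  have hseg : segment ℝ (q a) (q b) ⊆ q '' ball 0 ρ := by
    refine (convex_segment (q a) (q b)).isPreconnected.subset_of_closure_inter_subset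
      (isOpen_image_of_convex hq hq' (ball_subset_closedBall.trans hsub) isOpen_ball)
      ⟨q a, left_mem_segment _ _ _, a, by simpa using haρ, rfl⟩ ?_
    rintro x ⟨hx, hxs⟩
    obtain ⟨ζ, hζ, rfl⟩ := closure_minimal (image_mono ball_subset_closedBall) hclosed hx
    by_contra hnot
    have hζn : ‖ζ‖ = ρ := by
      refine le_antisymm (by simpa using hζ) (not_lt.1 fun h => hnot ⟨ζ, by simpa using h, rfl⟩)
    have hζ0 : ζ ≠ 0 := by rintro rfl; exact hρ0 (by simpa using hζn.symm)
    have hpa := re_pos_of_norm_le hq hq' hconv (hsub hζ) hζ0 (w := a) (by linarith)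
      (by rintro rfl; linarith)
    have hpb := re_pos_of_norm_le hq hq' hconv (hsub hζ) hζ0 (w := b) (by linarith)
      (by rintro rfl; linarith)
    obtain ⟨s, t, hs, ht, hst, he⟩ := hxs
    have hst' : (s : ℂ) + (t : ℂ) = 1 := by exact_mod_cast hst
    have hz : (s : ℂ) * ((q ζ - q a) / (ζ * deriv q ζ)) +
        (t : ℂ) * ((q ζ - q b) / (ζ * deriv q ζ)) = 0 := by
      simp only [Complex.real_smul] at he
      have : (s : ℂ) * (q ζ - q a) + t * (q ζ - q b) = 0 := by
        linear_combination q ζ * hst' - he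
      rw [← mul_div_assoc, ← mul_div_assoc, ← add_div, this, zero_div]
    have hz' := congrArg Complex.re hz
    rw [Complex.add_re, Complex.re_ofReal_mul, Complex.re_ofReal_mul, Complex.zero_re] at hz'
    rcases hs.eq_or_lt with h | h
    · have : t = 1 := by linarith
      rw [← h, this] at hz'
      linarith
    · nlinarith [mul_pos h hpa, mul_nonneg ht hpb.le]
  exact hseg.trans (image_mono (ball_subset_closedBall.trans hsub))

/-- The local inverse of an injective analytic function is analytic. -/
theorem hasDerivAt_invFunOn (hq : AnalyticOnNhd ℂ q (ball 0 1))
    (hq' : ∀ z ∈ ball (0 : ℂ) 1, deriv q z ≠ 0) (hinj : InjOn q (ball 0 1))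
    {z : ℂ} (hz : z ∈ ball (0 : ℂ) 1) :
    HasDerivAt (Function.invFunOn q (ball 0 1)) (deriv q z)⁻¹ (q z) := by
  set g := Function.invFunOn q (ball 0 1)
  have hgz : g (q z) = z := hinj.leftInvOn_invFunOn hz
  refine HasDerivAt.of_local_left_inverse (f := q) ?_ ?_ (hq' z hz) ?_
  · rw [ContinuousAt, hgz]
    intro U hU
    obtain ⟨V, hVU, hVo, hzV⟩ := _root_.mem_nhds_iff.1 (inter_mem hU (isOpen_ball.mem_nhds hz))
    have hVb : V ⊆ ball 0 1 := fun x hx => (hVU hx).2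
    refine Filter.mem_map.2 (mem_of_superset ((isOpen_image_of_convex hq hq' hVb hVo).mem_nhds ⟨z, hzV, rfl⟩) ?_)
    rintro _ ⟨x, hx, rfl⟩
    have : g (q x) = x := hinj.leftInvOn_invFunOn (hVb hx)
    rw [mem_preimage, this]
    exact (hVU hx).1
  · rw [hgz]; exact (hq z hz).differentiableAt.hasDerivAt
  · filter_upwards [(isOpen_image_of_convex hq hq' subset_rfl isOpen_ball).mem_nhds ⟨z, hz, rfl⟩]
      with y hy
    exact Function.invFunOn_eq hy

/-- A function whose derivative with respect to `q` has positive real part has difference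
quotients with respect to `q` of positive real part. -/
theorem re_div_sub_pos {h : ℂ → ℂ} (hq : AnalyticOnNhd ℂ q (ball 0 1))
    (hq' : ∀ z ∈ ball (0 : ℂ) 1, deriv q z ≠ 0)
    (hconv : ∀ z ∈ ball (0 : ℂ) 1, 0 < (1 + z * deriv (deriv q) z / deriv q z).re)
    (hh : AnalyticOnNhd ℂ h (ball 0 1))
    (hhq : ∀ z ∈ ball (0 : ℂ) 1, 0 < (deriv h z / deriv q z).re)
    {a b : ℂ} (ha : a ∈ ball (0 : ℂ) 1) (hb : b ∈ ball (0 : ℂ) 1) (hab : a ≠ b) :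
    0 < ((h b - h a) / (q b - q a)).re := by
  have hinj := injOn_of_convex hq hq' hconv
  set g := Function.invFunOn q (ball 0 1) with hg
  set σ : ℝ → ℂ := fun t => q a + t * (q b - q a) with hσ
  have hσmem : ∀ t ∈ Icc (0 : ℝ) 1, σ t ∈ q '' ball 0 1 := by
    intro t ht
    refine (convex_image_of_convex hq hq' hconv).segment_subset ⟨a, ha, rfl⟩ ⟨b, hb, rfl⟩ ?_
    refine ⟨1 - t, t, by linarith [ht.2], ht.1, by ring, ?_⟩
    simp only [hσ, Complex.real_smul]
    push_cast
    ring
  have hqab : q b - q a ≠ 0 := sub_ne_zero.2 fun h => hab (hinj hb ha h).symm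
  have hσd : ∀ t : ℝ, HasDerivAt σ (q b - q a) t := fun t => by
    simpa [hσ] using
      ((Complex.ofRealCLM.hasDerivAt (x := t)).mul_const (q b - q a)).const_add (q a)
  have hder : ∀ t ∈ Icc (0 : ℝ) 1, HasDerivAt (fun t => (h (g (σ t)) / (q b - q a)).re)
      ((deriv h (g (σ t)) / deriv q (g (σ t))).re) t := by
    intro t ht
    obtain ⟨z, hz, hzt⟩ := hσmem t ht
    have hgz : g (σ t) = z := by rw [← hzt]; exact hinj.leftInvOn_invFunOn hz
    have hgd := hasDerivAt_invFunOn hq hq' hinj hz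
    rw [hzt] at hgd
    have h1 := hgd.comp t (hσd t)
    have hhd : HasDerivAt h (deriv h z) (g (σ t)) := by
      rw [hgz]; exact (hh z hz).differentiableAt.hasDerivAt
    have h2 := (hhd.comp t h1).div_const (q b - q a)
    have h3 := Complex.reCLM.hasFDerivAt.comp_hasDerivAt t h2
    convert! h3 using 1
    simp only [hgz, Complex.reCLM_apply]
    congr 1
    have := hq' z hz
    field_simp
  -- The Noshiro–Warschawski argument: the mean value theorem for the real part of `h ∘ q⁻¹`, scaled
  -- by `q b - q a`, along the segment from `q a` to `q b`.
  obtain ⟨c, hc, he⟩ := exists_hasDerivAt_eq_slope (fun t => (h (g (σ t)) / (q b - q a)).re)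
    (fun t => (deriv h (g (σ t)) / deriv q (g (σ t))).re) zero_lt_one
    (fun t ht => (hder t ht).continuousAt.continuousWithinAt)
    (fun t ht => hder t (Ioo_subset_Icc_self ht))
  obtain ⟨z, hz, hzc⟩ := hσmem c (Ioo_subset_Icc_self hc)
  have hgz : g (σ c) = z := by rw [← hzc]; exact hinj.leftInvOn_invFunOn hz
  have h0 : g (σ 0) = a := by
    have : σ 0 = q a := by simp [hσ]
    rw [this]; exact hinj.leftInvOn_invFunOn ha
  have h1 : g (σ 1) = b := by
    have : σ 1 = q b := by simp [hσ]
    rw [this]; exact hinj.leftInvOn_invFunOn hb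
  rw [hgz, h0, h1, sub_zero, div_one, ← Complex.sub_re, ← sub_div] at he
  rw [← he]
  exact hhq z hz

/-- The image under `h` of a disk misses the outer normal rays of the convex function `q`. -/
theorem norm_le_of_eq_add_ray {h : ℂ → ℂ} (hq : AnalyticOnNhd ℂ q (ball 0 1))
    (hq' : ∀ z ∈ ball (0 : ℂ) 1, deriv q z ≠ 0)
    (hconv : ∀ z ∈ ball (0 : ℂ) 1, 0 < (1 + z * deriv (deriv q) z / deriv q z).re)
    (hh : AnalyticOnNhd ℂ h (ball 0 1))
    (hhq : ∀ z ∈ ball (0 : ℂ) 1, 0 < (deriv h z / deriv q z).re)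
    {ζ w : ℂ} (hζ : ζ ∈ ball (0 : ℂ) 1) (hw : w ∈ ball (0 : ℂ) 1) {t : ℝ} (ht : 0 ≤ t)
    (he : h w = h ζ + t * (ζ * deriv q ζ)) : ‖ζ‖ ≤ ‖w‖ := by
  by_contra! hlt
  have hζ0 : ζ ≠ 0 := by
    rintro rfl
    exact absurd hlt (by simp)
  have hne : w ≠ ζ := by rintro rfl; exact lt_irrefl _ hlt
  have hB := re_pos_of_norm_le hq hq' hconv hζ hζ0 hlt.le hne
  have hA := re_div_sub_pos hq hq' hconv hh hhq hw hζ hne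
  have hd : q ζ - q w ≠ 0 := sub_ne_zero.2 fun h =>
    hne (injOn_of_convex hq hq' hconv hζ hw h).symm
  have hn : ζ * deriv q ζ ≠ 0 := mul_ne_zero hζ0 (hq' ζ hζ)
  set B := (q ζ - q w) / (ζ * deriv q ζ) with hBdef
  -- On the ray the difference quotient is `-t / B` with `Re B > 0`, so its real part cannot be
  -- positive.
  have e : (h ζ - h w) / (q ζ - q w) = ((-t : ℝ) : ℂ) * B⁻¹ := by
    rw [he, hBdef, inv_div]
    push_cast
    ring
  rw [e, Complex.re_ofReal_mul, Complex.inv_re] at hA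
  have : 0 ≤ B.re / Complex.normSq B := div_nonneg hB.le (Complex.normSq_nonneg _)
  nlinarith

/-! ### The differential subordination. -/

/-- Solutions of the Briot–Bouquet type subordination `p + z p' ≺ q + z q'` with `q` convex
satisfy `p ≺ q`. -/
theorem subordinate_of_convex {h p w : ℂ → ℂ} (hq : AnalyticOnNhd ℂ q (ball 0 1))
    (hq' : ∀ z ∈ ball (0 : ℂ) 1, deriv q z ≠ 0)
    (hconv : ∀ z ∈ ball (0 : ℂ) 1, 0 < (1 + z * deriv (deriv q) z / deriv q z).re)
    (hh : AnalyticOnNhd ℂ h (ball 0 1))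
    (hhq : ∀ z ∈ ball (0 : ℂ) 1, 0 < (deriv h z / deriv q z).re)
    (hqh : ∀ z ∈ ball (0 : ℂ) 1, h z = q z + z * deriv q z)
    (hp : AnalyticOnNhd ℂ p (ball 0 1)) (hp0 : p 0 = q 0) (hw : IsSchwarzFunction w)
    (hpw : ∀ z ∈ ball (0 : ℂ) 1, p z + z * deriv p z = h (w z)) :
    Subordinate p q := by
  have hinj := injOn_of_convex hq hq' hconv
  have h0mem := mem_ball_self (x := (0 : ℂ)) one_pos
  set g := Function.invFunOn q (ball 0 1) with hg
  set ω : ℂ → ℂ := fun z => g (p z) with hω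
  have hgq : ∀ z ∈ ball (0 : ℂ) 1, g (q z) = z := fun z hz => hinj.leftInvOn_invFunOn hz
  have hω0 : ω 0 = 0 := by simp only [hω]; rw [hp0, hgq 0 h0mem]
  set Ω := q '' ball 0 1 with hΩ
  have hΩo : IsOpen Ω := isOpen_image_of_convex hq hq' subset_rfl isOpen_ball
  have hωmem : ∀ z, p z ∈ Ω → ω z ∈ ball (0 : ℂ) 1 := fun z hz => Function.invFunOn_mem hz
  have hqω : ∀ z, p z ∈ Ω → q (ω z) = p z := fun z hz => Function.invFunOn_eq hz
  have hωd : ∀ z ∈ ball (0 : ℂ) 1, p z ∈ Ω →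
      HasDerivAt ω ((deriv q (ω z))⁻¹ * deriv p z) z := by
    intro z hz hpz
    have h1 := hasDerivAt_invFunOn hq hq' hinj (hωmem z hpz)
    rw [hqω z hpz] at h1
    exact h1.comp z (hp z hz).differentiableAt.hasDerivAt
  -- `ω` is meaningful only where `p` lands in `Ω`, so the estimate is proved on a disk where this
  -- is already known.
  have hest : ∀ R ≤ 1, (∀ z ∈ ball (0 : ℂ) R, p z ∈ Ω) → ∀ z ∈ ball (0 : ℂ) R, ‖ω z‖ ≤ ‖z‖ := by
    intro R hR hmaps z hz
    have hωdiff : DifferentiableOn ℂ ω (ball 0 R) := fun x hx =>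
      (hωd x (ball_subset_ball hR hx) (hmaps x hx)).differentiableAt.differentiableWithinAt
    have hsub : closedBall (0 : ℂ) ‖z‖ ⊆ ball 0 R := closedBall_subset_ball (by simpa using hz)
    obtain ⟨z₀, hz₀, hmax⟩ := (isCompact_closedBall (0 : ℂ) ‖z‖).exists_isMaxOn
      ⟨z, by simp⟩ (hωdiff.continuousOn.mono hsub).norm
    have hz₀n : ‖z₀‖ ≤ ‖z‖ := by simpa using hz₀
    have hzz : ‖ω z‖ ≤ ‖ω z₀‖ := hmax (by simp)
    refine hzz.trans (le_trans ?_ hz₀n)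
    by_cases hne : ω z₀ = 0
    · simp [hne]
    have hz₀R := hsub hz₀
    have hz₀1 := ball_subset_ball hR hz₀R
    obtain ⟨m, hm, hj⟩ := jack_lemma hωdiff hω0 (by simpa using hz₀R) hne
      (fun x hx => hmax (by simpa using hx.trans hz₀n))
    have hwz : ‖w z₀‖ ≤ ‖z₀‖ := Complex.norm_le_norm_of_mapsTo_ball hw.1.differentiableOn
      (hw.2.1.mono_right ball_subset_closedBall) hw.2.2 (by simpa using hz₀1)
    refine le_trans ?_ hwz
    have hmem := hωmem z₀ (hmaps z₀ hz₀R)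
    refine norm_le_of_eq_add_ray hq hq' hconv hh hhq hmem (hw.2.1 hz₀1)
      (t := m - 1) (by linarith) ?_
    rw [← hpw z₀ hz₀1, hqh _ hmem, hqω z₀ (hmaps z₀ hz₀R)]
    rw [(hωd z₀ hz₀1 (hmaps z₀ hz₀R)).deriv] at hj
    have hqne := hq' _ hmem
    have : z₀ * deriv p z₀ = m * ω z₀ * deriv q (ω z₀) := by
      rw [← hj]; field_simp
    rw [this]
    push_cast
    ring
  -- Continuation in the radius: on the largest admissible disk `‖ω z‖ ≤ ‖z‖` puts `p` into a
  -- compact part of `Ω`, so a radius below `1` could be enlarged.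
  set T : Set ℝ := {R | R ≤ 1 ∧ ∀ z ∈ ball (0 : ℂ) R, p z ∈ Ω} with hT
  have hTne : (0 : ℝ) ∈ T := ⟨zero_le_one, by simp⟩
  have hTbdd : BddAbove T := ⟨1, fun R hR => hR.1⟩
  have hST : sSup T ∈ T := by
    refine ⟨csSup_le ⟨0, hTne⟩ fun R hR => hR.1, fun z hz => ?_⟩
    obtain ⟨R, hR, hzR⟩ := exists_lt_of_lt_csSup ⟨0, hTne⟩ (mem_ball_zero_iff.1 hz)
    exact hR.2 z (by simpa using hzR)
  have hS1 : sSup T = 1 := by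
    by_contra hne
    set r := sSup T with hr
    have hlt : r < 1 := hST.1.lt_of_ne hne
    have hr0 : 0 ≤ r := le_csSup hTbdd hTne
    have hclosed : ∀ z ∈ closedBall (0 : ℂ) r, p z ∈ Ω := by
      rcases hr0.eq_or_lt with h0 | hpos
      · intro z hz
        rw [← h0, closedBall_zero, mem_singleton_iff] at hz
        rw [hz, hp0]
        exact ⟨0, h0mem, rfl⟩
      · have hsub : closedBall (0 : ℂ) r ⊆ ball 0 1 := closedBall_subset_ball hlt
        have hK : IsClosed (q '' closedBall 0 r) :=
          ((isCompact_closedBall _ _).image_of_continuousOn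
            (hq.continuousOn.mono hsub)).isClosed
        have hmaps : MapsTo p (ball 0 r) (q '' closedBall 0 r) := by
          intro z hz
          refine ⟨ω z, ?_, hqω z (hST.2 z hz)⟩
          have := hest r hST.1 hST.2 z hz
          rw [mem_closedBall_zero_iff]
          exact this.trans (by simpa using (mem_ball_zero_iff.1 hz).le)
        have hcl : MapsTo p (closure (ball 0 r)) (closure (q '' closedBall 0 r)) := by
          refine hmaps.closure_of_continuousOn ?_
          rw [closure_ball _ hpos.ne']
          exact hp.continuousOn.mono hsub
        rw [closure_ball _ hpos.ne', hK.closure_eq] at hcl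
        exact fun z hz => image_mono hsub (hcl hz)
    have hUo : IsOpen (ball (0 : ℂ) 1 ∩ p ⁻¹' Ω) :=
      hp.continuousOn.isOpen_inter_preimage isOpen_ball hΩo
    obtain ⟨δ, hδ, hδsub⟩ := (isCompact_closedBall (0 : ℂ) r).exists_thickening_subset_open hUo
      (fun z hz => ⟨closedBall_subset_ball hlt hz, hclosed z hz⟩)
    rw [thickening_closedBall hδ hr0] at hδsub
    have : min (δ + r) 1 ∈ T := ⟨min_le_right _ _, fun z hz =>
      (hδsub (ball_subset_ball (min_le_left _ _) hz)).2⟩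
    have h1 := le_csSup hTbdd this
    rw [← hr] at h1
    rcases min_le_iff.1 h1 with h | h <;> linarith
  rw [hS1] at hST
  refine ⟨ω, ⟨DifferentiableOn.analyticOnNhd (fun z hz =>
    (hωd z hz (hST.2 z hz)).differentiableAt.differentiableWithinAt) isOpen_ball,
    fun z hz => hωmem z (hST.2 z hz), hω0⟩, fun z hz => (hqω z (hST.2 z hz)).symm⟩

end Convex

/-! ### Return to `f`. -/

/-- If `f f'' / f'²` has the analytic extension `F`, then `f = f' · (z - ∫₀ᶻ F)`. -/
theorem eq_deriv_mul_sub_primitive {f F Φ : ℂ → ℂ} (hf : IsNormalizedAnalytic f)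
    (hΦ0 : Φ 0 = 0) (hΦ : ∀ z ∈ ball (0 : ℂ) 1, HasDerivAt Φ (F z) z)
    (hF : ∀ z ∈ ball (0 : ℂ) 1, (deriv f z) ^ 2 ≠ 0 →
      F z = f z * deriv (deriv f) z / (deriv f z) ^ 2) :
    ∀ z ∈ ball (0 : ℂ) 1, f z = deriv f z * (z - Φ z) := by
  obtain ⟨hfa, hf0, hf1⟩ := hf
  have h0 := mem_ball_self (x := (0 : ℂ)) one_pos
  have hΦa : AnalyticOnNhd ℂ Φ (ball 0 1) := DifferentiableOn.analyticOnNhd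
    (fun z hz => (hΦ z hz).differentiableAt.differentiableWithinAt) isOpen_ball
  -- Division by `f'` is safe only near `0`; the product form of the identity then extends to the
  -- whole disk by analyticity.
  refine hfa.eqOn_of_preconnected_of_eventuallyEq (hfa.deriv.mul (analyticOnNhd_id.sub hΦa))
    (convex_ball (0 : ℂ) 1).isPreconnected h0 ?_
  have hne : ∀ᶠ z in 𝓝 (0 : ℂ), z ∈ ball (0 : ℂ) 1 ∧ deriv f z ≠ 0 :=
    (isOpen_ball.eventually_mem h0).and
      ((hfa.deriv 0 h0).continuousAt.eventually_ne (by rw [hf1]; exact one_ne_zero))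
  obtain ⟨ε, hε, hεsub⟩ := Metric.eventually_nhds_iff_ball.1 hne
  have hd : ∀ z ∈ ball (0 : ℂ) ε, HasDerivAt (fun z => f z / deriv f z - (z - Φ z)) 0 z := by
    intro z hz
    obtain ⟨hz1, hz2⟩ := hεsub z hz
    have h1 := ((hfa z hz1).differentiableAt.hasDerivAt.fun_div
      (hfa.deriv z hz1).differentiableAt.hasDerivAt hz2).fun_sub
      ((hasDerivAt_id z).fun_sub (hΦ z hz1))
    convert! h1 using 1
    rw [hF z hz1 (pow_ne_zero 2 hz2)]
    field_simp
    ring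
  filter_upwards [ball_mem_nhds (0 : ℂ) hε] with z hz
  have := isOpen_ball.is_const_of_deriv_eq_zero (convex_ball (0 : ℂ) ε).isPreconnected
    (fun z hz => (hd z hz).differentiableAt.differentiableWithinAt)
    (fun z hz => (hd z hz).deriv) hz (mem_ball_self hε)
  simp only [hf0, hΦ0, zero_div, sub_zero] at this
  have h2 := (hεsub z hz).2
  rw [sub_eq_zero, div_eq_iff h2] at this
  exact this.trans (mul_comm _ _)

theorem mainTheorem9 (ψ h : ℂ → ℂ) (hψ : IsMaMinda ψ)
    (hh : AnalyticOnNhd ℂ h (ball 0 1)) (hh0 : h 0 = 0) (hh1 : deriv h 0 ≠ 0)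
    (hre : ∀ z ∈ ball (0 : ℂ) 1,
      -(1 / 2 : ℝ) < (1 + z * deriv (deriv h) z / deriv h z).re)
    (hint : QuotientSubordinate (integralFromZero h) (fun z => z)
      (fun z => (ψ z - 1) / ψ z))
    (f : ℂ → ℂ) (hf : IsNormalizedAnalytic f)
    (hsub : QuotientSubordinate (fun z => f z * deriv (deriv f) z)
      (fun z => (deriv f z) ^ 2) h) :
    f ∈ starlikeClass ψ := by
  have h0 := mem_ball_self (x := (0 : ℂ)) one_pos
  obtain ⟨F, hFa, hFq, w, hw, hFw⟩ := hsub
  obtain ⟨G, hGa, hGq, u, hu, hGu⟩ := hint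
  obtain ⟨Φh, q, hΦh0, hΦh, hq, hΦq, hqh⟩ := exists_average hh
  obtain ⟨ΦF, p, hΦF0, hΦF, hp, hΦp, hpF⟩ := exists_average hFa
  have hcv := convexity_of_average hq hh hh1 hre hqh
  have hq0 : q 0 = 0 := by simpa [hh0] using (hqh 0 h0).symm
  have hp0 : p 0 = 0 := by
    have := hpF 0 h0
    rw [hFw 0 h0, hw.2.2, hh0] at this
    simpa using this.symm
  obtain ⟨ω, hω, hpω⟩ := subordinate_of_convex hq (fun z hz => (hcv z hz).1)
    (fun z hz => (hcv z hz).2.2) hh (fun z hz => one_pos.trans (hcv z hz).2.1) hqh hp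
    (hp0.trans hq0.symm) hw (fun z hz => by rw [← hFw z hz, hpF z hz])
  have hψ0 : ∀ z ∈ ball (0 : ℂ) 1, ψ z ≠ 0 := fun z hz he => by
    have := hψ.re_pos z hz
    simp [he] at this
  have hqG : ∀ z ∈ ball (0 : ℂ) 1, q z = (ψ (u z) - 1) / ψ (u z) := by
    intro z hz
    -- The quotient hypothesis is silent at the origin, where both sides are zero by normalisation.
    by_cases hz0 : z = 0
    · rw [hz0, hq0, hu.2.2, hψ.map_zero, sub_self, zero_div]
    · refine Eq.trans ?_ (hGu z hz)
      rw [hGq z hz hz0, integralFromZero_eq hh hΦh0 hΦh hz, hΦq,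
        mul_div_cancel_left₀ _ hz0]
  have hfeq := eq_deriv_mul_sub_primitive hf hΦF0 hΦF hFq
  refine ⟨hf, fun z => ψ (u (ω z)), ?_, ?_, fun z => u (ω z), ⟨?_, ?_, ?_⟩, fun z _ => rfl⟩
  · exact hψ.analytic.comp (hu.1.comp hω.1 hω.2.1) (hu.2.1.comp hω.2.1)
  · intro z hz hfz
    have hψz := hψ0 _ (hu.2.1 (hω.2.1 hz))
    have e := hfeq z hz
    -- Substituting `p = 1 - 1 / ψ(u(ω))` turns `f = z f' (1 - p)` into `f ψ(u(ω)) = z f'`.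
    rw [hΦp, hpω z hz, hqG _ (hω.2.1 hz)] at e
    have e2 : f z * ψ (u (ω z)) = z * deriv f z := by
      rw [e]
      field_simp
      ring
    simp only
    rw [eq_div_iff hfz, mul_comm, e2]
  · exact hu.1.comp hω.1 hω.2.1
  · exact hu.2.1.comp hω.2.1
  · exact (congrArg u hω.2.2).trans hu.2.2
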